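/- Let $(G_n)_{n\in\mathbb N}$ be a sequence of finite non-empty simple graphs. A modeling is a simple graph $L$ on a standard Borel space together with a probability measure $\nu$ such that for every $p\ge 0$ and every first-order formula $\varphi$ in $p$ free variables the set of solutions $\varphi(L)=\{\mathbf v\in V(L)^p : L\models\varphi(\mathbf v)\}$ is measurable. The Stone pairing $\langle\varphi,G\rangle$ of $\varphi$ with a finite graph $G$ is the probability that a uniformly random $p$-tuple of vertices of $G$ satisfies $\varphi$, and $\langle\varphi,L\rangle=\nu^{\otimes p}(\varphi(L))$ for a modeling $L$ (for a sentence, the value is $1$ if it holds and $0$ otherwise). The sequence $(G_n)$ FO-converges to the modeling $L$ if $\lim_n\langle\varphi,G_n\rangle=\langle\varphi,L\rangle$ for every first-order formula $\varphi$ in the language of graphs. The same definitions apply to rooted graphs $(G,r)$, with formulas in the language of graphs extended by one constant symbol that is interpreted as the root $r$. Suppose that $(G_n)$ FO-converges to a modeling $L$, and let $\xi(x)$ be a first-order formula in one free variable in the language of graphs whose set of solutions $\xi(L)$ is finite and non-empty. Then there are vertices $r_n\in V(G_n)$, $n\in\mathbb N$, and a vertex $r\in\xi(L)$ such that $(L,r)$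 is a modeling and $(G_n,r_n)$ FO-converges to $(L,r)$. -/

import Mathlib

namespace StructuralConvergence

universe u v

/-- The set of solutions `φ(S) = {v ∈ V ^ p : S ⊨ φ(v)}` of a first-order formula `φ` in `p` free
variables in a structure `S` on the vertex set `V`. -/
def solutionSet {L : FirstOrder.Language.{0, 0}} {V : Type u} (S : L.Structure V) {p : ℕ}
    (φ : L.Formula (Fin p)) : Set (Fin p → V) :=
  {x | φ.Realize x}

/-- The Stone pairing of `φ` with a finite structure: the probability that a uniformly random
`p`-tuple of vertices satisfies `φ`. For a sentence (`p = 0`) there is exactly one tuple, so the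
value is `1` or `0` according to whether `φ` holds. -/
noncomputable def finiteStonePairing {L : FirstOrder.Language.{0, 0}} {V : Type u} (S : L.Structure V)
    {p : ℕ} (φ : L.Formula (Fin p)) : ℝ :=
  ((solutionSet S φ).ncard : ℝ) / (Nat.card V : ℝ) ^ p

/-- The Stone pairing of `φ` with a structure carrying a measure `ν`: the measure of the set of
solutions of `φ` in the `p`-th power of `ν`. -/
noncomputable def measureStonePairing {L : FirstOrder.Language.{0, 0}} {V : Type u} (S : L.Structure V)
    [MeasurableSpace V] (ν : MeasureTheory.Measure V) {p : ℕ} (φ : L.Formula (Fin p)) : ℝ :=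
  (MeasureTheory.Measure.pi (fun _ : Fin p => ν)).real (solutionSet S φ)

/-- A modeling: a structure on a standard Borel space with a probability measure, all of whose
first-order definable sets are measurable. -/
structure IsModeling {L : FirstOrder.Language.{0, 0}} {V : Type u} (S : L.Structure V)
    [MeasurableSpace V] (ν : MeasureTheory.Measure V) : Prop where
  standardBorel : StandardBorelSpace V
  isProbabilityMeasure : MeasureTheory.IsProbabilityMeasure ν
  measurableSet_solutionSet : ∀ (p : ℕ) (φ : L.Formula (Fin p)), MeasurableSet (solutionSet S φ)

/-- The sequence of finite structures `S n` is FO-convergent with modeling limit `(T, ν)`: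
`(T, ν)` is a modeling and, for each formula `φ`, the Stone pairings of `φ` with `S n` converge
to the Stone pairing of `φ` with `(T, ν)`. -/
structure FOConvergesTo {L : FirstOrder.Language.{0, 0}} {V : ℕ → Type u} (S : ∀ n, L.Structure (V n))
    {W : Type v} (T : L.Structure W) [MeasurableSpace W] (ν : MeasureTheory.Measure W) :
    Prop where
  isModeling : IsModeling T ν
  tendsto : ∀ (p : ℕ) (φ : L.Formula (Fin p)),
    Filter.Tendsto (fun n => finiteStonePairing (S n) φ) Filter.atTop
      (nhds (measureStonePairing T ν φ))

/-- A formula is algebraic in a structure if its set of solutions is finite. -/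
def IsAlgebraicFormula {L : FirstOrder.Language.{0, 0}} {V : Type u} (S : L.Structure V) {p : ℕ}
    (φ : L.Formula (Fin p)) : Prop :=
  (solutionSet S φ).Finite

/-- The language of rooted graphs: the language of graphs with one added constant, the root. -/
abbrev rootedGraph : FirstOrder.Language.{0, 0} :=
  FirstOrder.Language.graph.withConstants Unit

/-- The rooted graph `(G, r)`: the graph `G` with the constant interpreted as `r`. -/
@[reducible] def rootedStructure {V : Type u} (G : SimpleGraph V) (r : V) :
    rootedGraph.Structure V :=
  letI : FirstOrder.Language.graph.Structure V := G.structure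
  letI : (FirstOrder.Language.constantsOn Unit).Structure V :=
    FirstOrder.Language.constantsOn.structure (fun _ : Unit => r)
  FirstOrder.Language.withConstantsStructure (L := FirstOrder.Language.graph) (M := V) Unit

end StructuralConvergence

open StructuralConvergence

/-!
Every solution `s` of `ξ` in the limit can serve as the root. To a formula `φ` with a root variable
and to a vertex `r` belongs the number `⟨φ(r, ·)⟩`, the probability that a random tuple satisfies
`φ` with root `r` (`rootedPairing`), and the roots `r n` have to be chosen so that all these
numbers converge to their values at `s`.

The sum of `⟨φ(r, ·)⟩` over all solutions `r` of `ξ` is a sum, over `j` up to the number of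
solutions, of the pairings of the formulas "at least `j` solutions `r` of `ξ` satisfy `φ(r, x)`"
(`sum_rootedPairing_eq`). These formulas have no root, so the sums converge along the sequence.
Products of pairings at a common root are again pairings, by independence of disjoint groups of
variables (`rootedPairing_rootedConj`). Hence all polynomials in the numbers `⟨φ(r, ·)⟩` have
convergent sums over the roots (`tendsto_sum_of_mem_adjoin`); in other words the multisets of
types of the roots converge in all moments.

With `z i` the pairings of finitely many formulas and `a i` their values at `s`, the polynomial
`∏ i, (1 - (z i - a i) ^ 2) ^ N` is `1` at `s`, nonnegative, and uniformly small at roots for which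
some `z i` is not close to `a i`. Since the number of roots is bounded, some root of each late
structure has all `z i` close to `a i` (`eventually_exists_root_near`). As there are countably many
formulas, a diagonal choice gives the sequence of roots (`exists_seq_forall_tendsto`).

Finite structures are treated as modelings with the uniform measure, so that one notion of pairing
serves on both sides of the limit.
-/

open MeasureTheory Filter Topology FirstOrder Language

namespace StructuralConvergence

universe w

variable {L : FirstOrder.Language.{0, 0}} {V : Type w}

/-! ### Pairings of formulas with a parameter -/

section Pairing

variable (S : L.Structure V) {α β : Type}

/-- The set of solutions of a formula, with free variables indexed by an arbitrary type. -/
def realizeSet (φ : L.Formula α) : Set (α → V) :=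
  {x | φ.Realize x}

/-- The set of solutions of `φ`, whose free variables are a root, indexed by `Unit`, and
variables indexed by `α`, when the root takes the value `r`. -/
def rootedSet (φ : L.Formula (Unit ⊕ α)) (r : V) : Set (α → V) :=
  {x | φ.Realize (Sum.elim (fun _ => r) x)}

/-- The Stone pairing of `φ`, where the root variable takes the value `r` and the variables
indexed by `α` are chosen independently at random. -/
noncomputable def rootedPairing [MeasurableSpace V] (ν : Measure V) [Fintype α]
    (φ : L.Formula (Unit ⊕ α)) (r : V) : ℝ :=
  (Measure.pi fun _ : α => ν).real (rootedSet S φ r)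

variable {S} [MeasurableSpace V] {ν : Measure V}

theorem IsModeling.measurableSet_realizeSet [Finite α] (hS : IsModeling S ν) (φ : L.Formula α) :
    MeasurableSet (realizeSet S φ) := by
  obtain ⟨p, ⟨e⟩⟩ := Finite.exists_equiv_fin α
  have h := hS.measurableSet_solutionSet p (φ.relabel e)
  have hm : Measurable fun x : α → V => x ∘ e.symm :=
    measurable_pi_lambda _ fun i => measurable_pi_apply _
  convert hm h using 1
  ext x
  simp [realizeSet, solutionSet, Function.comp_assoc]

theorem IsModeling.measurableSet_rootedSet [Finite α] (hS : IsModeling S ν)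
    (φ : L.Formula (Unit ⊕ α)) (r : V) : MeasurableSet (rootedSet S φ r) := by
  have hm : Measurable fun x : α → V => (Sum.elim (fun _ => r) x : Unit ⊕ α → V) := by
    refine measurable_pi_lambda _ fun i => ?_
    rcases i with i | i
    · exact measurable_const
    · exact measurable_pi_apply i
  exact hm (hS.measurableSet_realizeSet φ)

theorem real_realizeSet_eq_measureStonePairing [Fintype α] [IsProbabilityMeasure ν] {p : ℕ}
    (e : α ≃ Fin p) (φ : L.Formula α) :
    (Measure.pi fun _ : α => ν).real (realizeSet S φ) =
      measureStonePairing S ν (φ.relabel e) := by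
  have h := measurePreserving_arrowCongr' (fun _ : α => ν) (fun _ : Fin p => ν) e
    (MeasurableEquiv.refl V) fun _ => MeasurePreserving.id ν
  rw [measureStonePairing, Measure.real, Measure.real, ← h.measure_preimage_equiv]
  congr 2
  ext x
  simp only [realizeSet, solutionSet, Set.mem_ofPred_eq, Set.mem_preimage, Formula.realize_relabel]
  refine iff_of_eq (congrArg _ ?_)
  ext i
  simp [MeasurableEquiv.arrowCongr', Equiv.arrowCongr', Equiv.arrowCongr]

theorem rootedPairing_nonneg [Fintype α] (φ : L.Formula (Unit ⊕ α)) (r : V) :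
    0 ≤ rootedPairing S ν φ r :=
  measureReal_nonneg

theorem rootedPairing_le_one [Fintype α] [IsProbabilityMeasure ν] (φ : L.Formula (Unit ⊕ α))
    (r : V) : rootedPairing S ν φ r ≤ 1 :=
  measureReal_le_one

theorem rootedPairing_top [Fintype α] [IsProbabilityMeasure ν] (r : V) :
    rootedPairing S ν (⊤ : L.Formula (Unit ⊕ α)) r = 1 := by
  have h : rootedSet S (⊤ : L.Formula (Unit ⊕ α)) r = Set.univ := by
    ext x
    simp [rootedSet]
  rw [rootedPairing, h, probReal_univ]

/-- The conjunction of two formulas that share only the root variable. -/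
def rootedConj (φ : L.Formula (Unit ⊕ α)) (ψ : L.Formula (Unit ⊕ β)) :
    L.Formula (Unit ⊕ (α ⊕ β)) :=
  φ.relabel (Sum.map id Sum.inl) ⊓ ψ.relabel (Sum.map id Sum.inr)

/-- Independence of the two groups of variables makes pairings at a fixed root multiplicative. -/
theorem rootedPairing_rootedConj [Fintype α] [Fintype β] [IsProbabilityMeasure ν]
    (φ : L.Formula (Unit ⊕ α)) (ψ : L.Formula (Unit ⊕ β)) (r : V) :
    rootedPairing S ν (rootedConj φ ψ) r = rootedPairing S ν φ r * rootedPairing S ν ψ r := by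
  have h := measurePreserving_sumPiEquivProdPi (X := fun _ : α ⊕ β => V) fun _ => ν
  have hset : rootedSet S (rootedConj φ ψ) r =
      MeasurableEquiv.sumPiEquivProdPi (fun _ : α ⊕ β => V) ⁻¹'
        (rootedSet S φ r ×ˢ rootedSet S ψ r) := by
    ext x
    simp only [rootedSet, rootedConj, Set.mem_ofPred_eq, Set.mem_preimage, Set.mem_prod,
      Formula.realize_inf, Formula.realize_relabel]
    refine and_congr (iff_of_eq (congrArg _ ?_)) (iff_of_eq (congrArg _ ?_)) <;>
    · ext i
      rcases i with i | i <;> rfl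
  rw [rootedPairing, hset, Measure.real, h.measure_preimage_equiv, Measure.prod_prod,
    ENNReal.toReal_mul]
  rfl

end Pairing

/-! ### Counting roots by formulas -/

section Counting

variable {S : L.Structure V} {α : Type}

/-- The formula asserting that at least `j` values of the root satisfy `φ`. -/
noncomputable def atLeast (j : ℕ) (φ : L.Formula (Unit ⊕ α)) : L.Formula α :=
  Formula.iExs (Fin j)
    ((Formula.iInf fun i : Fin j => φ.relabel (Sum.elim (fun _ => Sum.inr i) Sum.inl)) ⊓
      Formula.iInf fun q : {q : Fin j × Fin j // q.1 ≠ q.2} =>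
        ∼(Term.equal (Term.var (Sum.inr q.1.1)) (Term.var (Sum.inr q.1.2))))

theorem realize_atLeast {j : ℕ} {φ : L.Formula (Unit ⊕ α)} {x : α → V} {F : Finset V}
    (hF : ∀ r, r ∈ F ↔ x ∈ rootedSet S φ r) :
    (atLeast j φ).Realize x ↔ j ≤ F.card := by
  have h : (atLeast j φ).Realize x ↔
      ∃ y : Fin j → V, (∀ i, y i ∈ F) ∧ Function.Injective y := by
    simp only [atLeast, Formula.realize_iExs, Formula.realize_inf, Formula.realize_iInf,
      Formula.realize_relabel, Formula.realize_not, Formula.realize_equal, Term.realize_var,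
      Sum.elim_inr, hF, rootedSet, Set.mem_ofPred_eq]
    refine exists_congr fun y => and_congr (forall_congr' fun i => iff_of_eq (congrArg _ ?_)) ?_
    · ext k
      rcases k with k | k <;> rfl
    · constructor
      · intro hy a b hab
        by_contra hne
        exact hy ⟨(a, b), hne⟩ hab
      · rintro hy ⟨⟨a, b⟩, hne⟩ hab
        exact hne (hy hab)
  rw [h]
  constructor
  · rintro ⟨y, hy, hinj⟩
    simpa using Finset.card_le_card_of_injOn y (s := Finset.univ) (fun i _ => hy i)
      hinj.injOn
  · intro hj
    obtain ⟨f⟩ := Function.Embedding.nonempty_of_card_le (α := Fin j) (β := F) (by simpa using hj)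
    exact ⟨fun i => f i, fun i => (f i).2, fun a b hab => f.injective (Subtype.ext hab)⟩

/-- Double counting: the sum of the measures of the sets `A r` is the sum over `j` of the measures
of the sets of points that lie in more than `j` of them. -/
theorem sum_measureReal_eq_sum_lt_card {X ι : Type*} [MeasurableSpace X] (μ : Measure X)
    [IsFiniteMeasure μ] (F : Finset ι) {A : ι → Set X} [∀ x, DecidablePred fun r => x ∈ A r]
    (hA : ∀ r ∈ F, MeasurableSet (A r)) {K : ℕ} (hK : F.card ≤ K) {B : ℕ → Set X}
    (hB : ∀ j, MeasurableSet (B j)) (hBA : ∀ j x, x ∈ B j ↔ j < (F.filter fun r => x ∈ A r).card) :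
    ∑ r ∈ F, μ.real (A r) = ∑ j ∈ Finset.range K, μ.real (B j) := by
  classical
  have hint : ∀ {C : Set X}, MeasurableSet C → Integrable (C.indicator (1 : X → ℝ)) μ :=
    fun hC => (integrable_const (1 : ℝ)).indicator hC
  have h1 : ∑ r ∈ F, μ.real (A r) = ∫ x, ∑ r ∈ F, (A r).indicator 1 x ∂μ := by
    rw [integral_finsetSum _ fun r hr => hint (hA r hr)]
    exact Finset.sum_congr rfl fun r hr => (integral_indicator_one (hA r hr)).symm
  have h2 : ∑ j ∈ Finset.range K, μ.real (B j) =
      ∫ x, ∑ j ∈ Finset.range K, (B j).indicator 1 x ∂μ := by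
    rw [integral_finsetSum _ fun j _ => hint (hB j)]
    exact Finset.sum_congr rfl fun j _ => (integral_indicator_one (hB j)).symm
  rw [h1, h2]
  congr 1
  ext x
  simp only [Set.indicator_apply, Pi.one_apply, Finset.sum_boole]
  congr 1
  have hle := (Finset.card_filter_le F fun r => x ∈ A r).trans hK
  have hx : (Finset.range K).filter (fun j => x ∈ B j) =
      Finset.range (F.filter fun r => x ∈ A r).card := by
    ext j
    simp only [Finset.mem_filter, Finset.mem_range, hBA]
    omega
  rw [hx, Finset.card_range]

/-- The formula `ξ(r) ∧ φ(r, x)`, which restricts the root variable of `φ` to solutions of `ξ`. -/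
def guardRoot (ξ : L.Formula (Fin 1)) (φ : L.Formula (Unit ⊕ α)) : L.Formula (Unit ⊕ α) :=
  ξ.relabel (fun _ => Sum.inl ()) ⊓ φ

theorem mem_rootedSet_guardRoot {ξ : L.Formula (Fin 1)} {φ : L.Formula (Unit ⊕ α)} {r : V}
    {x : α → V} : x ∈ rootedSet S (guardRoot ξ φ) r ↔
      (fun _ => r) ∈ solutionSet S ξ ∧ x ∈ rootedSet S φ r := by
  simp only [rootedSet, guardRoot, solutionSet, Set.mem_ofPred_eq, Formula.realize_inf,
    Formula.realize_relabel]
  rfl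

/-- The sum of the pairings of `φ` over all roots in `ξ` is a sum of pairings without a root. The
number of summands depends only on a bound for the number of roots, so the identity holds with the
same formulas in all structures with at most `K` roots. -/
theorem sum_rootedPairing_eq [MeasurableSpace V] {ν : Measure V} [Fintype α]
    (hS : IsModeling S ν) {ξ : L.Formula (Fin 1)} (φ : L.Formula (Unit ⊕ α)) {F : Finset V}
    (hF : ∀ r, r ∈ F ↔ (fun _ => r) ∈ solutionSet S ξ) {K : ℕ} (hK : F.card ≤ K) :
    ∑ r ∈ F, rootedPairing S ν φ r =
      ∑ j ∈ Finset.range K,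
        (Measure.pi fun _ : α => ν).real (realizeSet S (atLeast (j + 1) (guardRoot ξ φ))) := by
  classical
  have := hS.isProbabilityMeasure
  refine sum_measureReal_eq_sum_lt_card _ F (fun r _ => hS.measurableSet_rootedSet φ r) hK
    (fun j => hS.measurableSet_realizeSet _) fun j x => ?_
  refine realize_atLeast (S := S) fun r => ?_
  rw [Finset.mem_filter, hF, mem_rootedSet_guardRoot]

end Counting

/-! ### Convergence of sums over the roots -/

section Convergence

universe u v

variable {L : FirstOrder.Language.{0, 0}} {V : ℕ → Type u} [∀ n, MeasurableSpace (V n)]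
  {S : ∀ n, L.Structure (V n)} {μ : ∀ n, Measure (V n)} {W : Type v} [MeasurableSpace W]
  {T : L.Structure W} {ν : Measure W}

theorem tendsto_real_realizeSet [∀ n, IsProbabilityMeasure (μ n)] [IsProbabilityMeasure ν]
    (hconv : ∀ (p : ℕ) (φ : L.Formula (Fin p)),
      Tendsto (fun n => measureStonePairing (S n) (μ n) φ) atTop (𝓝 (measureStonePairing T ν φ)))
    {α : Type} [Fintype α] (φ : L.Formula α) :
    Tendsto (fun n => (Measure.pi fun _ : α => μ n).real (realizeSet (S n) φ)) atTop
      (𝓝 ((Measure.pi fun _ : α => ν).real (realizeSet T φ))) := by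
  simp_rw [real_realizeSet_eq_measureStonePairing (Fintype.equivFin α)]
  exact hconv _ _

/-- The number of roots is eventually at most the number of roots of the limit: having more is
expressed by a sentence, whose pairings are `0` or `1` and tend to `0`. -/
theorem eventually_card_roots_le [∀ n, IsProbabilityMeasure (μ n)] [IsProbabilityMeasure ν]
    (hconv : ∀ (p : ℕ) (φ : L.Formula (Fin p)),
      Tendsto (fun n => measureStonePairing (S n) (μ n) φ) atTop (𝓝 (measureStonePairing T ν φ)))
    {ξ : L.Formula (Fin 1)} {F : ∀ n, Finset (V n)}
    (hF : ∀ n r, r ∈ F n ↔ (fun _ => r) ∈ solutionSet (S n) ξ) {F' : Finset W}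
    (hF' : ∀ r, r ∈ F' ↔ (fun _ => r) ∈ solutionSet T ξ) :
    ∀ᶠ n in atTop, (F n).card ≤ F'.card := by
  set φ : L.Formula Empty := atLeast (F'.card + 1) (guardRoot ξ ⊤) with hφ
  have hlim : (Measure.pi fun _ : Empty => ν).real (realizeSet T φ) = 0 := by
    have h : realizeSet T φ = ∅ := by
      ext x
      have hx := realize_atLeast (S := T) (j := F'.card + 1) (φ := guardRoot ξ ⊤) (x := x)
        (F := F') fun r => by rw [mem_rootedSet_guardRoot, hF']; simp [rootedSet]
      simpa [realizeSet, hφ] using hx.not.2 (by omega)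
    rw [h, measureReal_empty]
  have ht := tendsto_real_realizeSet hconv φ
  rw [hlim] at ht
  filter_upwards [ht.eventually_lt_const one_pos] with n hn
  by_contra! hlt
  have h : realizeSet (S n) φ = Set.univ := by
    refine Set.eq_univ_of_forall fun x => ?_
    exact (realize_atLeast (S := S n) (j := F'.card + 1) (φ := guardRoot ξ ⊤) (x := x)
      (F := F n) fun r => by rw [mem_rootedSet_guardRoot, hF]; simp [rootedSet]).2 hlt
  rw [h, probReal_univ] at hn
  exact lt_irrefl _ hn

/-- Once the number of roots is bounded, the sum over the roots is given by finitely many fixed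
formulas, to which the assumed convergence applies. -/
theorem tendsto_sum_rootedPairing (hS : ∀ n, IsModeling (S n) (μ n)) (hT : IsModeling T ν)
    (hconv : ∀ (p : ℕ) (φ : L.Formula (Fin p)),
      Tendsto (fun n => measureStonePairing (S n) (μ n) φ) atTop (𝓝 (measureStonePairing T ν φ)))
    {ξ : L.Formula (Fin 1)} {F : ∀ n, Finset (V n)}
    (hF : ∀ n r, r ∈ F n ↔ (fun _ => r) ∈ solutionSet (S n) ξ) {F' : Finset W}
    (hF' : ∀ r, r ∈ F' ↔ (fun _ => r) ∈ solutionSet T ξ)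
    {α : Type} [Fintype α] (φ : L.Formula (Unit ⊕ α)) :
    Tendsto (fun n => ∑ r ∈ F n, rootedPairing (S n) (μ n) φ r) atTop
      (𝓝 (∑ r ∈ F', rootedPairing T ν φ r)) := by
  have := fun n => (hS n).isProbabilityMeasure
  have := hT.isProbabilityMeasure
  rw [sum_rootedPairing_eq hT φ hF' le_rfl]
  refine (tendsto_finsetSum _ fun j _ => tendsto_real_realizeSet hconv
    (atLeast (j + 1) (guardRoot ξ φ))).congr' ?_
  filter_upwards [eventually_card_roots_le hconv hF hF'] with n hn
  rw [sum_rootedPairing_eq (hS n) φ (hF n) hn]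

variable (S μ T ν) in
/-- A formula with a root variable gives a function of the root on each structure of the sequence
and on the limit; these families of functions form a submonoid of the algebra of all families of
real functions on the structures. -/
noncomputable def pairingSubmonoid [∀ n, IsProbabilityMeasure (μ n)] [IsProbabilityMeasure ν] :
    Submonoid ((∀ n, V n → ℝ) × (W → ℝ)) where
  carrier := {h | ∃ (α : Type) (_ : Fintype α) (φ : L.Formula (Unit ⊕ α)),
    h = (fun n => rootedPairing (S n) (μ n) φ, rootedPairing T ν φ)}
  one_mem' := by
    refine ⟨Empty, inferInstance, ⊤, Prod.ext ?_ ?_⟩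
    · ext n r
      exact (rootedPairing_top r).symm
    · ext r
      exact (rootedPairing_top r).symm
  mul_mem' := by
    rintro _ _ ⟨α, _, φ, rfl⟩ ⟨β, _, ψ, rfl⟩
    refine ⟨α ⊕ β, inferInstance, rootedConj φ ψ, Prod.ext ?_ ?_⟩
    · ext n r
      exact (rootedPairing_rootedConj φ ψ r).symm
    · ext r
      exact (rootedPairing_rootedConj φ ψ r).symm

/-- Sums over the roots converge for every polynomial in pairings, because such a polynomial is a
linear combination of pairings. -/
theorem tendsto_sum_of_mem_adjoin (hS : ∀ n, IsModeling (S n) (μ n)) (hT : IsModeling T ν)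
    [∀ n, IsProbabilityMeasure (μ n)] [IsProbabilityMeasure ν]
    (hconv : ∀ (p : ℕ) (φ : L.Formula (Fin p)),
      Tendsto (fun n => measureStonePairing (S n) (μ n) φ) atTop (𝓝 (measureStonePairing T ν φ)))
    {ξ : L.Formula (Fin 1)} {F : ∀ n, Finset (V n)}
    (hF : ∀ n r, r ∈ F n ↔ (fun _ => r) ∈ solutionSet (S n) ξ) {F' : Finset W}
    (hF' : ∀ r, r ∈ F' ↔ (fun _ => r) ∈ solutionSet T ξ) {h : (∀ n, V n → ℝ) × (W → ℝ)}
    (hh : h ∈ Algebra.adjoin ℝ (pairingSubmonoid S μ T ν : Set ((∀ n, V n → ℝ) × (W → ℝ)))) :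
    Tendsto (fun n => ∑ r ∈ F n, h.1 n r) atTop (𝓝 (∑ r ∈ F', h.2 r)) := by
  rw [← Subalgebra.mem_toSubmodule, Algebra.adjoin_eq_span, Submonoid.closure_eq] at hh
  induction hh using Submodule.span_induction with
  | mem h hh =>
    obtain ⟨α, _, φ, rfl⟩ := hh
    exact tendsto_sum_rootedPairing hS hT hconv hF hF' φ
  | zero => simp
  | add f g _ _ hf hg => simpa [Finset.sum_add_distrib] using hf.add hg
  | smul c f _ hf => simpa [Finset.mul_sum] using hf.const_mul c

/-- Around the value of a root `s` of the limit, finitely many pairings are eventually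
approximated by their values at a single root of the structures in the sequence. -/
theorem eventually_exists_root_near (hS : ∀ n, IsModeling (S n) (μ n)) (hT : IsModeling T ν)
    (hconv : ∀ (p : ℕ) (φ : L.Formula (Fin p)),
      Tendsto (fun n => measureStonePairing (S n) (μ n) φ) atTop (𝓝 (measureStonePairing T ν φ)))
    {ξ : L.Formula (Fin 1)} {F : ∀ n, Finset (V n)}
    (hF : ∀ n r, r ∈ F n ↔ (fun _ => r) ∈ solutionSet (S n) ξ) {F' : Finset W}
    (hF' : ∀ r, r ∈ F' ↔ (fun _ => r) ∈ solutionSet T ξ) {s : W} (hs : s ∈ F')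
    (J : Finset (Σ p : ℕ, L.Formula (Unit ⊕ Fin p))) {ε : ℝ} (hε : 0 < ε) (hε1 : ε < 1) :
    ∀ᶠ n in atTop, ∃ r ∈ F n, ∀ i ∈ J,
      |rootedPairing (S n) (μ n) i.2 r - rootedPairing T ν i.2 s| < ε := by
  have := fun n => (hS n).isProbabilityMeasure
  have := hT.isProbabilityMeasure
  classical
  have hbound : ∀ x a : ℝ, 0 ≤ x → x ≤ 1 → 0 ≤ a → a ≤ 1 → 0 ≤ 1 - (x - a) ^ 2 := by
    intro x a hx0 hx1 ha0 ha1
    nlinarith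
  have hK : (0 : ℝ) < 1 / (2 * (F'.card + 1)) := by positivity
  obtain ⟨N, hN⟩ := exists_pow_lt_of_lt_one hK (show 1 - ε ^ 2 < 1 by nlinarith)
  -- A polynomial with value `1` at the target values, small whenever some coordinate is far off.
  let z : (Σ p : ℕ, L.Formula (Unit ⊕ Fin p)) → (∀ n, V n → ℝ) × (W → ℝ) := fun i =>
    (fun n => rootedPairing (S n) (μ n) i.2, rootedPairing T ν i.2)
  let h : (∀ n, V n → ℝ) × (W → ℝ) :=
    ∏ i ∈ J, (1 - (z i - algebraMap ℝ _ (rootedPairing T ν i.2 s)) ^ 2) ^ N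
  have hmem : h ∈
      Algebra.adjoin ℝ (pairingSubmonoid S μ T ν : Set ((∀ n, V n → ℝ) × (W → ℝ))) := by
    refine prod_mem fun i _ => pow_mem (sub_mem (one_mem _) (pow_mem (sub_mem ?_ ?_) _)) _
    · exact Algebra.subset_adjoin ⟨Fin i.1, inferInstance, i.2, rfl⟩
    · exact Subalgebra.algebraMap_mem _ _
  have h1 : ∀ n r, h.1 n r = ∏ i ∈ J,
      (1 - (rootedPairing (S n) (μ n) i.2 r - rootedPairing T ν i.2 s) ^ 2) ^ N := by
    intro n r
    simp [h, z, Prod.fst_prod, Finset.prod_apply]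
  have h2 : ∀ r, h.2 r = ∏ i ∈ J,
      (1 - (rootedPairing T ν i.2 r - rootedPairing T ν i.2 s) ^ 2) ^ N := by
    intro r
    simp [h, z, Prod.snd_prod, Finset.prod_apply]
  have hlim : 1 / 2 < ∑ r ∈ F', h.2 r := by
    have hle : h.2 s ≤ ∑ r ∈ F', h.2 r := by
      refine Finset.single_le_sum (fun r _ => ?_) hs
      rw [h2]
      exact Finset.prod_nonneg fun i _ => pow_nonneg (hbound _ _ (rootedPairing_nonneg _ _)
        (rootedPairing_le_one _ _) (rootedPairing_nonneg _ _) (rootedPairing_le_one _ _)) _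
    have hone : h.2 s = 1 := by simp [h2]
    linarith
  filter_upwards [(tendsto_sum_of_mem_adjoin hS hT hconv hF hF' hmem).eventually_const_lt hlim,
    eventually_card_roots_le hconv hF hF'] with n hn hcard
  -- If all roots were far off, the sum of `h` over the at most `F'.card` roots would be too small.
  by_contra! hfar
  have hsmall : ∀ r ∈ F n, h.1 n r ≤ 1 / (2 * (F'.card + 1)) := by
    intro r hr
    obtain ⟨i, hi, hir⟩ := hfar r hr
    have h0 : ∀ j ∈ J,
        0 ≤ 1 - (rootedPairing (S n) (μ n) j.2 r - rootedPairing T ν j.2 s) ^ 2 :=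
      fun j _ => hbound _ _ (rootedPairing_nonneg _ _) (rootedPairing_le_one _ _)
        (rootedPairing_nonneg _ _) (rootedPairing_le_one _ _)
    rw [h1, ← Finset.mul_prod_erase _ _ hi]
    refine (mul_le_of_le_one_right (pow_nonneg (h0 i hi) _) ?_).trans
      ((pow_le_pow_left₀ (h0 i hi) ?_ N).trans hN.le)
    · refine Finset.prod_le_one (fun j hj => pow_nonneg (h0 j (Finset.mem_of_mem_erase hj)) _)
        fun j hj => pow_le_one₀ (h0 j (Finset.mem_of_mem_erase hj)) ?_
      linarith [sq_nonneg (rootedPairing (S n) (μ n) j.2 r - rootedPairing T ν j.2 s)]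
    · have := pow_le_pow_left₀ hε.le hir 2
      rw [sq_abs] at this
      linarith
  have hsum := Finset.sum_le_card_nsmul _ _ _ hsmall
  have hc : ((F n).card : ℝ) ≤ F'.card := by exact_mod_cast hcard
  rw [nsmul_eq_mul] at hsum
  have : ((F n).card : ℝ) * (1 / (2 * (F'.card + 1))) ≤ 1 / 2 := by
    rw [mul_one_div, div_le_div_iff₀ (by positivity) (by norm_num)]
    linarith
  linarith

/-- Diagonalization: if finitely many coordinates at a time can be approximated, then a single
choice approximates all of countably many coordinates. -/
theorem exists_seq_forall_tendsto {ι : Type*} [Countable ι] {X : ℕ → Type*} [∀ n, Finite (X n)]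
    [∀ n, Nonempty (X n)] (z : ∀ n, X n → ι → ℝ) (a : ι → ℝ)
    (h : ∀ (J : Finset ι) (ε : ℝ), 0 < ε → ε < 1 →
      ∀ᶠ n in atTop, ∃ r, ∀ i ∈ J, |z n r i - a i| < ε) :
    ∃ r : ∀ n, X n, ∀ i, Tendsto (fun n => z n (r n) i) atTop (𝓝 (a i)) := by
  -- The countable product is metrizable; a minimizer of the distance to `a` is a good choice.
  let := TopologicalSpace.metrizableSpaceMetric (ι → ℝ)
  choose r hr using fun n => Finite.exists_min fun x => dist (z n x) a
  refine ⟨r, fun i => ?_⟩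
  suffices Tendsto (fun n => z n (r n)) atTop (𝓝 a) from tendsto_pi_nhds.1 this i
  rw [Metric.tendsto_nhds]
  intro δ hδ
  have hball : {x | dist x a < δ} ∈ 𝓝 a := Metric.ball_mem_nhds a hδ
  rw [nhds_pi, Filter.mem_pi'] at hball
  obtain ⟨J, t, ht, hsub⟩ := hball
  have hev : ∀ᶠ ε in 𝓝[>] (0 : ℝ), ∀ i ∈ J, ∀ y, |y - a i| < ε → y ∈ t i := by
    rw [Finset.eventually_all]
    intro i _
    obtain ⟨ε₀, hε₀, hsub₀⟩ := Metric.mem_nhds_iff.1 (ht i)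
    filter_upwards [Ioo_mem_nhdsGT hε₀] with ε hε y hy
    exact hsub₀ (by rw [Metric.mem_ball, Real.dist_eq]; exact hy.trans hε.2)
  obtain ⟨ε, hε, hε0, hε1⟩ := (hev.and (Ioo_mem_nhdsGT one_pos)).exists
  filter_upwards [h J ε hε0 hε1] with n ⟨x, hx⟩
  exact (hr n x).trans_lt (hsub fun i hi => hε i hi _ (hx i hi))

end Convergence

/-! ### Finite structures as modelings -/

section Finite

variable {L : FirstOrder.Language.{0, 0}} {V : Type*} [Finite V] [Nonempty V] [MeasurableSpace V]
  [DiscreteMeasurableSpace V]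

theorem isModeling_uniformOn (S : L.Structure V) :
    IsModeling S (ProbabilityTheory.uniformOn Set.univ) where
  standardBorel := inferInstance
  isProbabilityMeasure :=
    ProbabilityTheory.isProbabilityMeasure_uniformOn Set.finite_univ Set.univ_nonempty
  measurableSet_solutionSet _ _ := (Set.toFinite _).measurableSet

theorem measureStonePairing_uniformOn (S : L.Structure V) {p : ℕ} (φ : L.Formula (Fin p)) :
    measureStonePairing S (ProbabilityTheory.uniformOn Set.univ) φ = finiteStonePairing S φ := by
  have := Fintype.ofFinite V
  have := (isModeling_uniformOn S).isProbabilityMeasure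
  have hfin := (solutionSet S φ).toFinite
  have hpt : ∀ x : Fin p → V, (Measure.pi fun _ : Fin p =>
      (ProbabilityTheory.uniformOn Set.univ : Measure V)).real {x} =
        ((Nat.card V : ℝ) ^ p)⁻¹ := by
    intro x
    rw [Measure.real, ← Set.univ_pi_singleton, Measure.pi_pi]
    simp [ProbabilityTheory.uniformOn_univ]
  rw [measureStonePairing, finiteStonePairing, ← hfin.coe_toFinset, Set.ncard_coe_finset,
    ← sum_measureReal_singleton, Finset.sum_congr rfl fun x _ => hpt x, Finset.sum_const,
    nsmul_eq_mul, div_eq_mul_inv]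

end Finite

/-! ### Rooted graphs -/

/-- A formula in the language of rooted graphs is a formula in the language of graphs in which the
constant symbol has been replaced by a variable. -/
theorem solutionSet_rootedStructure {V : Type*} (G : SimpleGraph V) (r : V) {p : ℕ}
    (φ : rootedGraph.Formula (Fin p)) :
    solutionSet (rootedStructure G r) φ =
      rootedSet G.structure (BoundedFormula.constantsVarsEquiv φ) r := by
  let : FirstOrder.Language.graph.Structure V := G.structure
  let : (FirstOrder.Language.constantsOn Unit).Structure V :=
    FirstOrder.Language.constantsOn.structure (fun _ : Unit => r)
  ext x
  exact (BoundedFormula.realize_constantsVarsEquiv (L := FirstOrder.Language.graph)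
    (α := Unit) (φ := φ) (v := x) (xs := default)).symm

/-- Fixing a root preserves modelings: its solution sets are sections of solution sets. -/
theorem isModeling_rootedStructure {W : Type*} [MeasurableSpace W] {G : SimpleGraph W}
    {ν : Measure W} (hG : IsModeling G.structure ν) (s : W) :
    IsModeling (rootedStructure G s) ν where
  standardBorel := hG.standardBorel
  isProbabilityMeasure := hG.isProbabilityMeasure
  measurableSet_solutionSet p φ := by
    rw [solutionSet_rootedStructure]
    exact hG.measurableSet_rootedSet _ s

theorem measureStonePairing_rootedStructure {W : Type*} [MeasurableSpace W] (G : SimpleGraph W)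
    (ν : Measure W) (s : W) {p : ℕ} (φ : rootedGraph.Formula (Fin p)) :
    measureStonePairing (rootedStructure G s) ν φ =
      rootedPairing G.structure ν (BoundedFormula.constantsVarsEquiv φ) s := by
  rw [measureStonePairing, solutionSet_rootedStructure, rootedPairing]

instance : Countable FirstOrder.Language.graph.Symbols := by
  have : Finite (Σ n, FirstOrder.Language.graph.Relations n) :=
    Finite.of_injective (fun _ => ()) fun ⟨_, .adj⟩ ⟨_, .adj⟩ _ => rfl
  have : IsEmpty (Σ n, FirstOrder.Language.graph.Functions n) := ⟨fun q => nomatch q.2⟩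
  unfold FirstOrder.Language.Symbols
  infer_instance

end StructuralConvergence

open StructuralConvergence
theorem theorem2 {V : ℕ → Type*} [∀ n, Finite (V n)] [∀ n, Nonempty (V n)]
    (G : ∀ n, SimpleGraph (V n))
    {W : Type*} [MeasurableSpace W] (L : SimpleGraph W) (ν : MeasureTheory.Measure W)
    (hL : FOConvergesTo (fun n => (G n).structure) L.structure ν)
    (ξ : FirstOrder.Language.graph.Formula (Fin 1))
    (hξ : IsAlgebraicFormula L.structure ξ)
    (hne : (solutionSet L.structure ξ).Nonempty) :
    ∃ (r : ∀ n, V n) (s : W), (fun _ => s) ∈ solutionSet L.structure ξ ∧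
      FOConvergesTo (fun n => rootedStructure (G n) (r n)) (rootedStructure L s) ν := by
  let : ∀ n, MeasurableSpace (V n) := fun _ => ⊤
  have hconv : ∀ (p : ℕ) (φ : FirstOrder.Language.graph.Formula (Fin p)),
      Tendsto (fun n => measureStonePairing (G n).structure
        (ProbabilityTheory.uniformOn Set.univ) φ) atTop
        (𝓝 (measureStonePairing L.structure ν φ)) := by
    intro p φ
    simp_rw [measureStonePairing_uniformOn]
    exact hL.tendsto p φ
  obtain ⟨x, hx⟩ := hne
  have hx' : (fun _ => x 0) ∈ solutionSet L.structure ξ := by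
    rwa [show (fun _ => x 0) = x from funext fun i => by rw [Subsingleton.elim i 0] ]
  have hfin : {r : W | (fun _ => r) ∈ solutionSet L.structure ξ}.Finite :=
    hξ.preimage fun a _ b _ hab => congrFun hab 0
  obtain ⟨r, hr⟩ := exists_seq_forall_tendsto
    (ι := Σ p : ℕ, FirstOrder.Language.graph.Formula (Unit ⊕ Fin p))
    (fun n r i => rootedPairing (G n).structure (ProbabilityTheory.uniformOn Set.univ) i.2 r)
    (fun i => rootedPairing L.structure ν i.2 (x 0)) fun J ε hε hε1 =>
      (eventually_exists_root_near (fun n => isModeling_uniformOn (G n).structure) hL.isModeling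
        hconv (ξ := ξ) (F := fun n => (Set.toFinite {r | (fun _ => r) ∈
          solutionSet (G n).structure ξ}).toFinset) (F' := hfin.toFinset)
        (fun n r => by simp) (fun r => by simp) (s := x 0) (by simpa using hx') J hε hε1).mono
        fun n ⟨r, _, h⟩ => ⟨r, h⟩
  refine ⟨r, x 0, hx', isModeling_rootedStructure hL.isModeling _, fun p φ => ?_⟩
  simp_rw [← measureStonePairing_uniformOn, measureStonePairing_rootedStructure]
  exact hr ⟨p, BoundedFormula.constantsVarsEquiv φ⟩
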